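/- Let $\mathbb H$ be the skew field of quaternions, $\mathbb S=\{q\in\mathbb H : q^2=-1\}$, and let $\mathsf H$ be a quaternionic Hilbert space, i.e. a right $\mathbb H$-module, complete for the norm $\|u\|=\sqrt{\langle u|u\rangle}$, with a Hermitian $\mathbb H$-valued scalar product $\langle\cdot|\cdot\rangle$ that is right $\mathbb H$-linear in the second variable. Let $\mathfrak B(\mathsf H)$ be the set of bounded right $\mathbb H$-linear operators $\mathsf H\to\mathsf H$, $\mathrm I$ the identity operator, and let $T^*$ denote the adjoint of $T$, so $\langle T^*u|v\rangle=\langle u|Tv\rangle$. For $T\in\mathfrak B(\mathsf H)$ and $q\in\mathbb H$ put $\Delta_q(T)=T^2-T(q+\overline q)+\mathrm I|q|^2$. The spherical spectrum $\sigma_S(T)\subset\mathbb H$ is the complement of the set of all $q\in\mathbb H$ such that $\Delta_q(T)$ is injective, has dense range, and has a bounded inverse $\mathrm{Ran}(\Delta_q(T))\to\mathsf H$. For $\imath\in\mathbb S$ put $\mathbb C_\imath=\{\alpha+\imath\beta : \alpha,\beta\in\mathbb R\}$, identified with $\mathbb C$ via $\alpha+i\beta\mapsto\alpha+\imath\beta$.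 For $\mathcal K\subset\mathbb C$ the circularization of $\mathcal K$ is $\Omega_{\mathcal K}=\{\alpha+\jmath\beta : \alpha,\beta\in\mathbb R,\ \alpha+i\beta\in\mathcal K,\ \jmath\in\mathbb S\}\subset\mathbb H$. Let $T\in\mathfrak B(\mathsf H)$ be normal ($TT^*=T^*T$), let $J\in\mathfrak B(\mathsf H)$ be anti-self-adjoint ($J^*=-J$) and unitary ($JJ^*=J^*J=\mathrm I$) with $TJ=JT$ and $T^*J=JT^*$, and let $\imath\in\mathbb S$. Put $\mathsf H_\pm^{J\imath}=\{u\in\mathsf H : Ju=\pm u\imath\}$; with the right multiplication by $\mathbb C_\imath\cong\mathbb C$ and the scalar product of $\mathsf H$ (which is $\mathbb C_\imath$-valued there), these are complex Hilbert spaces. Then: (a) $T(\mathsf H_+^{J\imath})\subset\mathsf H_+^{J\imath}$ and $T^*(\mathsf H_+^{J\imath})\subset\mathsf H_+^{J\imath}$. Moreover, the restrictions $T|_{\mathsf H_+^{J\imath}}$ and $T^*|_{\mathsf H_+^{J\imath}}$, which are bounded complex linear operators of $\mathsf H_+^{J\imath}$, satisfy, with $\sigma$ denoting the usual spectrum of a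 bounded operator on a complex Hilbert space: (b) $(T|_{\mathsf H_+^{J\imath}})^*=T^*|_{\mathsf H_+^{J\imath}}$. (c) $\sigma(T|_{\mathsf H_+^{J\imath}})\cup\overline{\sigma(T|_{\mathsf H_+^{J\imath}})}=\sigma_S(T)\cap\mathbb C_\imath$, where the bar is complex conjugation and the left-hand side is viewed as a subset of $\mathbb C_\imath$ via $\mathbb C\cong\mathbb C_\imath$. (d) $\sigma_S(T)=\Omega_{\mathcal K}$ with $\mathcal K=\sigma(T|_{\mathsf H_+^{J\imath}})$. The same statements (a)–(d) hold with $\mathsf H_-^{J\imath}$ in place of $\mathsf H_+^{J\imath}$. -/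

import Mathlib

open scoped Quaternion

/-- A quaternionic pre-Hilbert space: a right module over the quaternions, i.e. a module over the
opposite ring (so that `u q` is `MulOpposite.op q • u`), with a Hermitian quaternionic scalar product
that is right linear in the second variable and induces the norm `‖u‖ = √⟨u|u⟩`. A quaternionic
Hilbert space is one that is complete. -/
class QuaternionicInnerProductSpace (H : Type*) [NormedAddCommGroup H] [Module ℍᵐᵒᵖ H]
    extends Inner ℍ H where
  inner_add_right (u v w : H) : inner u (v + w) = inner u v + inner u w
  inner_smul_right (u v : H) (q : ℍ) : inner u (MulOpposite.op q • v) = inner u v * q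
  star_inner (u v : H) : star (inner v u) = inner u v
  inner_self (u : H) : inner u u = ((‖u‖ ^ 2 : ℝ) : ℍ)

namespace QuaternionicHilbert

variable {H : Type*} [NormedAddCommGroup H] [Module ℍᵐᵒᵖ H] [QuaternionicInnerProductSpace H]

section Basic

theorem inner_add_left (u v w : H) : inner ℍ (u + v) w = inner ℍ u w + inner ℍ v w := by
  rw [← QuaternionicInnerProductSpace.star_inner, QuaternionicInnerProductSpace.inner_add_right,
    star_add, QuaternionicInnerProductSpace.star_inner, QuaternionicInnerProductSpace.star_inner]

theorem inner_smul_left (u v : H) (q : ℍ) :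
    inner ℍ (MulOpposite.op q • u) v = star q * inner ℍ u v := by
  rw [← QuaternionicInnerProductSpace.star_inner, QuaternionicInnerProductSpace.inner_smul_right,
    star_mul, QuaternionicInnerProductSpace.star_inner]

theorem inner_neg_left (u v : H) : inner ℍ (-u) v = -inner ℍ u v := by
  have h := inner_smul_left u v (-1)
  simpa using h

theorem norm_op_smul (q : ℍ) (u : H) : ‖MulOpposite.op q • u‖ = ‖u‖ * ‖q‖ := by
  have h : (((‖MulOpposite.op q • u‖ ^ 2 : ℝ)) : ℍ) = (((‖u‖ * ‖q‖) ^ 2 : ℝ) : ℍ) := by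
    rw [← QuaternionicInnerProductSpace.inner_self, QuaternionicInnerProductSpace.inner_smul_right,
      inner_smul_left, QuaternionicInnerProductSpace.inner_self, mul_assoc,
      Quaternion.coe_commutes, ← mul_assoc, Quaternion.star_mul_self,
      Quaternion.normSq_eq_norm_mul_self, ← Quaternion.coe_mul]
    congr 1
    ring
  have h' := Quaternion.coe_injective h
  exact (sq_eq_sq₀ (norm_nonneg _) (by positivity)).1 h'

theorem continuous_op_smul (q : ℍ) : Continuous fun u : H => MulOpposite.op q • u := by
  refine AddMonoidHomClass.continuous_of_bound
    (DistribSMul.toAddMonoidHom H (MulOpposite.op q)) ‖q‖ fun u => ?_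
  rw [mul_comm]
  exact (norm_op_smul q u).le

end Basic

section Adjoint

/-- The real Hilbert space underlying a quaternionic Hilbert space (used only to construct
adjoints). -/
noncomputable abbrev realInnerProductSpace (H : Type*) [NormedAddCommGroup H] [Module ℍᵐᵒᵖ H]
    [QuaternionicInnerProductSpace H] : InnerProductSpace ℝ H :=
  { Module.compHom H (algebraMap ℝ ℍᵐᵒᵖ) with
    norm_smul_le := fun r u => by
      change ‖MulOpposite.op ((r : ℝ) : ℍ) • u‖ ≤ _
      rw [norm_op_smul, Quaternion.norm_coe, mul_comm]
    inner := fun u v => (inner ℍ u v).re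
    norm_sq_eq_re_inner := fun u => by
      change _ = (inner ℍ u u).re
      rw [QuaternionicInnerProductSpace.inner_self, Quaternion.re_coe]
    conj_inner_symm := fun u v => by
      change (inner ℍ v u).re = (inner ℍ u v).re
      rw [← QuaternionicInnerProductSpace.star_inner u v, Quaternion.re_star]
    add_left := fun u v w => by
      change (inner ℍ (u + v) w).re = (inner ℍ u w).re + (inner ℍ v w).re
      rw [inner_add_left, Quaternion.re_add]
    smul_left := fun u v r => by
      change (inner ℍ (MulOpposite.op ((r : ℝ) : ℍ) • u) v).re = r * (inner ℍ u v).re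
      rw [inner_smul_left, Quaternion.star_coe, Quaternion.coe_mul_eq_smul, Quaternion.re_smul,
        smul_eq_mul] }

theorem eq_of_forall_re_mul {a b : ℍ} (h : ∀ q : ℍ, (a * q).re = (b * q).re) : a = b := by
  have h1 : ((a - b) * star (a - b)).re = 0 := by
    rw [sub_mul, Quaternion.re_sub, h, sub_self]
  rw [Quaternion.self_mul_star, Quaternion.re_coe, Quaternion.normSq_eq_zero] at h1
  exact sub_eq_zero.1 h1

theorem ext_inner {u w : H} (h : ∀ v, inner ℍ u v = inner ℍ w v) : u = w := by
  have h1 : inner ℍ (u - w) (u - w) = 0 := by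
    rw [sub_eq_add_neg u w, inner_add_left, inner_neg_left, h, add_neg_cancel]
  rw [QuaternionicInnerProductSpace.inner_self] at h1
  have h2 : ‖u - w‖ ^ 2 = 0 := Quaternion.coe_injective (by simpa using h1)
  exact sub_eq_zero.1 (norm_eq_zero.1 (pow_eq_zero_iff two_ne_zero |>.1 h2))

theorem exists_adjoint [CompleteSpace H] (T : H →L[ℍᵐᵒᵖ] H) :
    ∃ S : H →L[ℍᵐᵒᵖ] H, ∀ u v, inner ℍ (S u) v = inner ℍ u (T v) := by
  let _ : InnerProductSpace ℝ H := realInnerProductSpace H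
  let R : H →L[ℝ] H :=
    { toFun := T
      map_add' := T.map_add
      map_smul' := fun r u => T.map_smul (MulOpposite.op (r : ℍ)) u
      cont := T.continuous }
  have key : ∀ u v, inner ℍ (ContinuousLinearMap.adjoint R u) v = inner ℍ u (T v) := by
    intro u v
    refine eq_of_forall_re_mul fun q => ?_
    have h : inner ℝ (ContinuousLinearMap.adjoint R u) (MulOpposite.op q • v)
        = inner ℝ u (R (MulOpposite.op q • v)) := ContinuousLinearMap.adjoint_inner_left R _ _
    have h' : (inner ℍ (ContinuousLinearMap.adjoint R u) (MulOpposite.op q • v)).re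
        = (inner ℍ u (T (MulOpposite.op q • v))).re := h
    rwa [T.map_smul, QuaternionicInnerProductSpace.inner_smul_right,
      QuaternionicInnerProductSpace.inner_smul_right] at h'
  refine ⟨{ toFun := ContinuousLinearMap.adjoint R
            map_add' := (ContinuousLinearMap.adjoint R).map_add
            map_smul' := fun q u => ?_
            cont := (ContinuousLinearMap.adjoint R).continuous }, key⟩
  refine ext_inner fun v => ?_
  obtain ⟨q, rfl⟩ := MulOpposite.op_surjective q
  rw [key, RingHom.id_apply, inner_smul_left, inner_smul_left, key]

/-- The adjoint `T*` of a bounded right linear operator `T`. -/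
noncomputable def adjoint [CompleteSpace H] (T : H →L[ℍᵐᵒᵖ] H) : H →L[ℍᵐᵒᵖ] H :=
  (exists_adjoint T).choose

/-- The property that characterizes the adjoint. -/
theorem adjoint_inner_left [CompleteSpace H] (T : H →L[ℍᵐᵒᵖ] H) (u v : H) :
    inner ℍ (adjoint T u) v = inner ℍ u (T v) :=
  (exists_adjoint T).choose_spec u v

end Adjoint

section SphericalSpectrum

/-- The operator `I r : u ↦ u r` for a real number `r`. -/
noncomputable def realScalar (H : Type*) [NormedAddCommGroup H] [Module ℍᵐᵒᵖ H]
    [QuaternionicInnerProductSpace H] (r : ℝ) : H →L[ℍᵐᵒᵖ] H where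
  toFun u := MulOpposite.op (r : ℍ) • u
  map_add' u v := smul_add _ u v
  map_smul' q u := by
    obtain ⟨q, rfl⟩ := MulOpposite.op_surjective q
    rw [RingHom.id_apply, smul_smul, smul_smul, ← MulOpposite.op_mul, ← MulOpposite.op_mul,
      Quaternion.coe_commutes]
  cont := continuous_op_smul _

/-- `Δ_q(T) = T² - T (q + q̄) + I |q|²`; the quaternion `q + q̄` is real. -/
noncomputable def sphericalDelta (q : ℍ) (T : H →L[ℍᵐᵒᵖ] H) : H →L[ℍᵐᵒᵖ] H :=
  T * T - T * realScalar H (q + star q).re + realScalar H (‖q‖ ^ 2)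

/-- The spherical resolvent set: `Δ_q(T)` is injective, has dense range, and its inverse, defined on
its range, is bounded. -/
def sphericalResolventSet (T : H →L[ℍᵐᵒᵖ] H) : Set ℍ :=
  {q | (∀ u, sphericalDelta q T u = 0 → u = 0) ∧
    DenseRange (sphericalDelta q T) ∧
    ∃ K : ℝ, ∀ u, ‖u‖ ≤ K * ‖sphericalDelta q T u‖}

/-- The spherical spectrum `σ_S(T)`. -/
def sphericalSpectrum (T : H →L[ℍᵐᵒᵖ] H) : Set ℍ :=
  (sphericalResolventSet T)ᶜ

end SphericalSpectrum

section Slices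

/-- The sphere `𝕊` of quaternionic imaginary units. -/
abbrev ImagUnit : Type := {q : ℍ // q * q = -1}

/-- The identification `ℂ → ℂ_ι`, `α + iβ ↦ α + ιβ`. -/
noncomputable def toSlice (ι : ImagUnit) (z : ℂ) : ℍ := (z.re : ℍ) + (ι : ℍ) * (z.im : ℍ)

/-- The subset `ℂ_ι = {α + ιβ | α, β ∈ ℝ}` of `ℍ`. -/
def slice (ι : ImagUnit) : Set ℍ := {q | ∃ α β : ℝ, q = (α : ℍ) + (ι : ℍ) * (β : ℍ)}

/-- The circularization `Ω_K = {α + jβ | α + iβ ∈ K, j ∈ 𝕊}` of a subset `K` of `ℂ`. -/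
def circularization (K : Set ℂ) : Set ℍ :=
  {q | ∃ (α β : ℝ) (j : ImagUnit), (⟨α, β⟩ : ℂ) ∈ K ∧ q = (α : ℍ) + (j : ℍ) * (β : ℍ)}

/-- The real linear projection of `ℍ` onto `ℂ_ι ≃ ℂ`; it is the inverse of `toSlice ι` on `ℂ_ι`
(see `toSlice_ofSlice`). -/
noncomputable def ofSlice (ι : ImagUnit) (q : ℍ) : ℂ := ⟨q.re, -((ι : ℍ) * q).re⟩

theorem ImagUnit.re_eq_zero (ι : ImagUnit) : (ι : ℍ).re = 0 := by
  obtain ⟨q, hq⟩ := ι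
  have h0 := congrArg QuaternionAlgebra.re hq
  have h1 := congrArg QuaternionAlgebra.imI hq
  have h2 := congrArg QuaternionAlgebra.imJ hq
  have h3 := congrArg QuaternionAlgebra.imK hq
  simp only [Quaternion.re_mul, Quaternion.imI_mul, Quaternion.imJ_mul, Quaternion.imK_mul,
    Quaternion.re_neg, Quaternion.imI_neg, Quaternion.imJ_neg, Quaternion.imK_neg,
    Quaternion.re_one, Quaternion.imI_one, Quaternion.imJ_one, Quaternion.imK_one] at h0 h1 h2 h3
  change q.re = 0
  by_contra hr
  have e1 : q.imI = 0 := by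
    have : q.re * q.imI = 0 := by linarith
    exact (mul_eq_zero.1 this).resolve_left hr
  have e2 : q.imJ = 0 := by
    have : q.re * q.imJ = 0 := by linarith
    exact (mul_eq_zero.1 this).resolve_left hr
  have e3 : q.imK = 0 := by
    have : q.re * q.imK = 0 := by linarith
    exact (mul_eq_zero.1 this).resolve_left hr
  rw [e1, e2, e3] at h0
  nlinarith [mul_self_nonneg q.re]

theorem ImagUnit.star_eq (ι : ImagUnit) : star (ι : ℍ) = -(ι : ℍ) :=
  Quaternion.star_eq_neg.2 ι.re_eq_zero

theorem toSlice_one (ι : ImagUnit) : toSlice ι 1 = 1 := by simp [toSlice]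

theorem toSlice_zero (ι : ImagUnit) : toSlice ι 0 = 0 := by simp [toSlice]

theorem toSlice_add (ι : ImagUnit) (z w : ℂ) : toSlice ι (z + w) = toSlice ι z + toSlice ι w := by
  simp only [toSlice, Complex.add_re, Complex.add_im, Quaternion.coe_add, mul_add]
  abel

theorem toSlice_mul (ι : ImagUnit) (z w : ℂ) : toSlice ι (z * w) = toSlice ι z * toSlice ι w := by
  have h : (ι : ℍ) * (z.im : ℍ) * ((ι : ℍ) * (w.im : ℍ)) = -((z.im : ℍ) * (w.im : ℍ)) := by
    rw [mul_assoc, ← mul_assoc (z.im : ℍ), Quaternion.coe_commutes z.im, mul_assoc, ← mul_assoc,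
      ι.2, neg_one_mul]
  have h' : (z.re : ℍ) * ((ι : ℍ) * (w.im : ℍ)) = (ι : ℍ) * ((z.re : ℍ) * (w.im : ℍ)) := by
    rw [← mul_assoc, Quaternion.coe_commutes, mul_assoc]
  simp only [toSlice, Complex.mul_re, Complex.mul_im, Quaternion.coe_add, Quaternion.coe_sub,
    Quaternion.coe_mul, add_mul, mul_add, h, h']
  rw [mul_assoc]
  abel

theorem ofSlice_star (ι : ImagUnit) (q : ℍ) : ofSlice ι (star q) = star (ofSlice ι q) := by
  apply Complex.ext
  · simp [ofSlice]
  · have h := ι.re_eq_zero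
    simp [ofSlice, Quaternion.re_mul, h]
    ring

theorem ofSlice_mul (ι : ImagUnit) (z : ℂ) (q : ℍ) :
    ofSlice ι (star (toSlice ι z) * q) = star z * ofSlice ι q := by
  have h : (ι : ℍ) * (star (toSlice ι z) * q) = (z.re : ℍ) * ((ι : ℍ) * q) + (z.im : ℍ) * q := by
    have e : star (toSlice ι z) = (z.re : ℍ) - (z.im : ℍ) * (ι : ℍ) := by
      simp [toSlice, ι.star_eq, sub_eq_add_neg]
    rw [e, sub_mul, mul_sub, ← mul_assoc, ← Quaternion.coe_commutes, mul_assoc,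
      mul_assoc (z.im : ℍ), ← mul_assoc (ι : ℍ), ← Quaternion.coe_commutes,
      mul_assoc (z.im : ℍ), ← mul_assoc (ι : ℍ), ι.2]
    simp
  have h2 : star (toSlice ι z) * q = (z.re : ℍ) * q - (z.im : ℍ) * ((ι : ℍ) * q) := by
    simp [toSlice, ι.star_eq, sub_eq_add_neg, add_mul, mul_assoc]
  apply Complex.ext
  · simp only [ofSlice, h2, Quaternion.coe_mul_eq_smul, Quaternion.re_sub, Quaternion.re_smul]
    simp
    ring
  · simp only [ofSlice, h, Quaternion.coe_mul_eq_smul, Quaternion.re_add, Quaternion.re_smul]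
    simp
    ring

/-- A quaternion lies in `ℂ_ι` as soon as it commutes with `ι`. -/
theorem toSlice_ofSlice (ι : ImagUnit) {q : ℍ} (hq : (ι : ℍ) * q = q * (ι : ℍ)) :
    toSlice ι (ofSlice ι q) = q := by
  obtain ⟨ι, hι⟩ := ι
  have hr := ImagUnit.re_eq_zero ⟨ι, hι⟩
  change ι.re = 0 at hr
  change ι * q = q * ι at hq
  have h0 := congrArg QuaternionAlgebra.re hι
  have h1 := congrArg QuaternionAlgebra.imI hq
  have h2 := congrArg QuaternionAlgebra.imJ hq
  have h3 := congrArg QuaternionAlgebra.imK hq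
  simp only [Quaternion.re_mul, Quaternion.imI_mul, Quaternion.imJ_mul, Quaternion.imK_mul,
    Quaternion.re_neg, Quaternion.re_one, hr] at h0 h1 h2 h3
  apply Quaternion.ext
  · simp [toSlice, ofSlice, hr]
  · simp [toSlice, ofSlice, Quaternion.re_mul, hr]
    linear_combination (-q.imI) * h0 + ι.imJ / 2 * h3 - ι.imK / 2 * h2
  · simp [toSlice, ofSlice, Quaternion.re_mul, hr]
    linear_combination (-q.imJ) * h0 + ι.imK / 2 * h1 - ι.imI / 2 * h3
  · simp [toSlice, ofSlice, Quaternion.re_mul, hr]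
    linear_combination (-q.imK) * h0 + ι.imI / 2 * h2 - ι.imJ / 2 * h1

end Slices

section ComplexSubspaces

/-- The complex subspaces `H_±^{Jι} = {u | J u = ± u ι}` of `H`; the sign `ε = 1` gives `H_+^{Jι}`
and `ε = -1` gives `H_-^{Jι}`. -/
def complexSubspace (J : H →L[ℍᵐᵒᵖ] H) (ι : ImagUnit) (ε : ℤˣ) : AddSubgroup H where
  carrier := {u | J u = ε • (MulOpposite.op (ι : ℍ) • u)}
  zero_mem' := by simp
  add_mem' {u v} hu hv := by
    simp only [Set.mem_ofPred_eq] at hu hv ⊢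
    rw [map_add, hu, hv, smul_add, smul_add]
  neg_mem' {u} hu := by
    simp only [Set.mem_ofPred_eq] at hu ⊢
    rw [map_neg, hu, smul_neg, smul_neg]

variable {J : H →L[ℍᵐᵒᵖ] H} {ι : ImagUnit} {ε : ℤˣ}

theorem mem_complexSubspace {u : H} :
    u ∈ complexSubspace J ι ε ↔ J u = ε • (MulOpposite.op (ι : ℍ) • u) := Iff.rfl

theorem op_smul_mem (z : ℂ) {u : H} (hu : u ∈ complexSubspace J ι ε) :
    MulOpposite.op (toSlice ι z) • u ∈ complexSubspace J ι ε := by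
  rw [mem_complexSubspace] at hu ⊢
  have h : toSlice ι z * (ι : ℍ) = (ι : ℍ) * toSlice ι z := by
    simp only [toSlice, add_mul, mul_add, Quaternion.coe_commutes, mul_assoc]
  rw [map_smul, hu, smul_comm, smul_smul, smul_smul, ← MulOpposite.op_mul, ← MulOpposite.op_mul, h]

/-- The complex Hilbert space structure of `H_±^{Jι}`: the norm is that of `H`, the complex scalar
multiplication is the right multiplication by `ℂ_ι ≃ ℂ`, and the scalar product is the one of `H`,
which is `ℂ_ι`-valued when `J* = -J` (see `toSlice_inner`). -/
noncomputable instance : InnerProductSpace ℂ (complexSubspace J ι ε) where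
  smul z u := ⟨MulOpposite.op (toSlice ι z) • (u : H), op_smul_mem z u.2⟩
  one_smul u := Subtype.ext <| by
    change MulOpposite.op (toSlice ι 1) • (u : H) = u
    rw [toSlice_one, MulOpposite.op_one, one_smul]
  mul_smul z w u := Subtype.ext <| by
    change MulOpposite.op (toSlice ι (z * w)) • (u : H)
      = MulOpposite.op (toSlice ι z) • (MulOpposite.op (toSlice ι w) • (u : H))
    rw [mul_comm z w, toSlice_mul, MulOpposite.op_mul, mul_smul]
  smul_zero z := Subtype.ext <| smul_zero (MulOpposite.op (toSlice ι z))
  smul_add z u v := Subtype.ext <| smul_add (MulOpposite.op (toSlice ι z)) (u : H) (v : H)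
  add_smul z w u := Subtype.ext <| by
    change MulOpposite.op (toSlice ι (z + w)) • (u : H)
      = MulOpposite.op (toSlice ι z) • (u : H) + MulOpposite.op (toSlice ι w) • (u : H)
    rw [toSlice_add, MulOpposite.op_add, add_smul]
  zero_smul u := Subtype.ext <| by
    change MulOpposite.op (toSlice ι 0) • (u : H) = 0
    rw [toSlice_zero, MulOpposite.op_zero, zero_smul]
  norm_smul_le z u := by
    change ‖MulOpposite.op (toSlice ι z) • (u : H)‖ ≤ ‖z‖ * ‖(u : H)‖
    have h : ‖toSlice ι z‖ = ‖z‖ := by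
      have h1 := ofSlice_mul ι z (toSlice ι z)
      rw [Quaternion.star_mul_self] at h1
      have h2 := congrArg Complex.re h1
      have h3 : ofSlice ι (toSlice ι z) = z := by
        apply Complex.ext
        · simp [ofSlice, toSlice, Quaternion.re_mul, ι.re_eq_zero]
        · simp only [ofSlice, toSlice, mul_add, ← mul_assoc, ι.2]
          simp [Quaternion.re_mul, ι.re_eq_zero]
      rw [h3] at h2
      simp only [ofSlice, Quaternion.re_coe, Quaternion.normSq_eq_norm_mul_self] at h2
      have h4 : ‖toSlice ι z‖ ^ 2 = ‖z‖ ^ 2 := by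
        rw [sq, h2, ← Complex.normSq_eq_norm_sq, Complex.normSq_apply]
        simp
      exact (sq_eq_sq₀ (norm_nonneg _) (norm_nonneg _)).1 h4
    rw [norm_op_smul, h, mul_comm]
  inner u v := ofSlice ι (inner ℍ (u : H) (v : H))
  norm_sq_eq_re_inner u := by
    change ‖(u : H)‖ ^ 2 = (inner ℍ (u : H) (u : H)).re
    rw [QuaternionicInnerProductSpace.inner_self, Quaternion.re_coe]
  conj_inner_symm u v := by
    change star (ofSlice ι (inner ℍ (v : H) (u : H))) = ofSlice ι (inner ℍ (u : H) (v : H))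
    rw [← ofSlice_star, QuaternionicInnerProductSpace.star_inner]
  add_left u v w := by
    change ofSlice ι (inner ℍ ((u : H) + (v : H)) (w : H))
      = ofSlice ι (inner ℍ (u : H) (w : H)) + ofSlice ι (inner ℍ (v : H) (w : H))
    rw [inner_add_left]
    apply Complex.ext
    · simp [ofSlice]
    · simp only [ofSlice, mul_add, Quaternion.re_add, neg_add, Complex.add_im]
  smul_left u v z := by
    change ofSlice ι (inner ℍ (MulOpposite.op (toSlice ι z) • (u : H)) (v : H))
      = star z * ofSlice ι (inner ℍ (u : H) (v : H))
    rw [inner_smul_left, ofSlice_mul]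

theorem coe_smul (z : ℂ) (u : complexSubspace J ι ε) :
    ((z • u : complexSubspace J ι ε) : H) = MulOpposite.op (toSlice ι z) • (u : H) := rfl

theorem toSlice_inner [CompleteSpace H] (hJ : adjoint J = -J) (u v : complexSubspace J ι ε) :
    toSlice ι (inner ℂ u v) = inner ℍ (u : H) (v : H) := by
  refine toSlice_ofSlice ι ?_
  have h := adjoint_inner_left J (u : H) (v : H)
  rw [hJ, neg_apply, mem_complexSubspace.1 u.2, mem_complexSubspace.1 v.2,
    inner_neg_left] at h
  rcases Int.units_eq_one_or ε with rfl | rfl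
  · rw [one_smul, one_smul, inner_smul_left, QuaternionicInnerProductSpace.inner_smul_right,
      ι.star_eq, neg_mul, neg_neg] at h
    exact h
  · have e : ∀ w : H, (-1 : ℤˣ) • (MulOpposite.op (ι : ℍ) • w) = MulOpposite.op (-(ι : ℍ)) • w := by
      intro w
      rw [Units.neg_smul, one_smul, MulOpposite.op_neg, neg_smul]
    rw [e, e, inner_smul_left, QuaternionicInnerProductSpace.inner_smul_right, star_neg,
      ι.star_eq, neg_neg, mul_neg, neg_inj] at h
    exact h

instance [CompleteSpace H] : CompleteSpace (complexSubspace J ι ε) := by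
  suffices h : IsClosed (complexSubspace J ι ε : Set H) from h.completeSpace_coe
  refine isClosed_eq J.continuous ?_
  rcases Int.units_eq_one_or ε with rfl | rfl
  · simpa using continuous_op_smul (H := H) (ι : ℍ)
  · simp only [Units.neg_smul, one_smul]
    exact (continuous_op_smul (H := H) (ι : ℍ)).neg

/-- The restriction to `H_±^{Jι}` of a bounded right linear operator that preserves it, as a bounded
complex linear operator. -/
noncomputable def restrict (J : H →L[ℍᵐᵒᵖ] H) (ι : ImagUnit) (ε : ℤˣ) (T : H →L[ℍᵐᵒᵖ] H)
    (hT : ∀ u ∈ complexSubspace J ι ε, T u ∈ complexSubspace J ι ε) :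
    complexSubspace J ι ε →L[ℂ] complexSubspace J ι ε where
  toFun u := ⟨T u, hT u u.2⟩
  map_add' u v := Subtype.ext <| T.map_add (u : H) (v : H)
  map_smul' z u := Subtype.ext <| T.map_smul (MulOpposite.op (toSlice ι z)) (u : H)
  cont := (T.continuous.comp continuous_subtype_val).subtype_mk _

end ComplexSubspaces

end QuaternionicHilbert

/-! Since `J² = -1`, the space splits as `H_+ ⊕ H_-`, the eigenspaces of `J` for `ι` and `-ι`, and
right multiplication by a nonzero quaternion `p` anticommuting with `ι` carries one onto the other.
So `H = H_± ⊕ H_± p` (`exists_eq_add_smul`), and a right linear operator commuting with `J` acts on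
both summands through the same restriction: it is bijective exactly when that restriction is
(`bijective_restrict_iff`).

This applies to `Δ_q(T)`. By completeness, `q` lies in the spherical resolvent set iff `Δ_q(T)` is
bijective (`mem_sphericalResolventSet_iff_bijective`). As `Δ_q(T)` depends only on `Re q` and `|q|`,
for any complex `z` with the same real part and modulus its restriction factors as `(z - A)(z̄ -
A)`, with `A` the restriction of `T` (`restrict_sphericalDelta`). The factors commute, so the
product is non-invertible iff `z` or `z̄` is in `σ(A)`. Both descriptions of `σ_S(T)` follow by
writing quaternions as `α + jβ`. -/

namespace QuaternionicHilbert

/-! ### Imaginary units and slices of the quaternions -/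

section Quaternions

/-- Because `κ² = -1`, every commutator `κx - xκ` anticommutes with `κ`. If all of them vanished,
`κ` would be central, hence real, which is impossible for a square root of `-1`. -/
theorem ImagUnit.exists_anticommute (κ : ImagUnit) :
    ∃ p : ℍ, p ≠ 0 ∧ p * (κ : ℍ) = -((κ : ℍ) * p) := by
  by_contra! hne
  have key : ∀ x : ℍ, (κ : ℍ) * x = x * (κ : ℍ) := by
    intro x
    by_contra hx
    refine hne ((κ : ℍ) * x - x * κ) (sub_ne_zero.2 hx) ?_
    rw [sub_mul, mul_sub, ← mul_assoc (κ : ℍ) (κ : ℍ), mul_assoc x, κ.2]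
    simp only [mul_assoc, neg_mul, mul_neg, one_mul, mul_one]
    abel
  obtain ⟨κ, hκ⟩ := κ
  have hr := ImagUnit.re_eq_zero ⟨κ, hκ⟩
  change κ.re = 0 at hr
  -- Commuting with `i` kills the `j` and `k` components of `κ`; commuting with `j` kills the `i`
  -- component.
  obtain ⟨i, i0, i1, i2, i3⟩ : ∃ i : ℍ, i.re = 0 ∧ i.imI = 1 ∧ i.imJ = 0 ∧ i.imK = 0 :=
    ⟨⟨0, 1, 0, 0⟩, rfl, rfl, rfl, rfl⟩
  obtain ⟨j, j0, j1, j2, j3⟩ : ∃ j : ℍ, j.re = 0 ∧ j.imI = 0 ∧ j.imJ = 1 ∧ j.imK = 0 :=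
    ⟨⟨0, 0, 1, 0⟩, rfl, rfl, rfl, rfl⟩
  have h1 := congrArg QuaternionAlgebra.imK (key i)
  have h2 := congrArg QuaternionAlgebra.imJ (key i)
  have h3 := congrArg QuaternionAlgebra.imK (key j)
  have h0 := congrArg QuaternionAlgebra.re hκ
  simp only [Quaternion.re_mul, Quaternion.imJ_mul, Quaternion.imK_mul, Quaternion.re_neg,
    Quaternion.re_one, hr, i0, i1, i2, i3, j0, j1, j2, j3] at h0 h1 h2 h3
  have e1 : κ.imI = 0 := by linarith
  have e2 : κ.imJ = 0 := by linarith
  have e3 : κ.imK = 0 := by linarith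
  simp [e1, e2, e3] at h0

theorem re_add_imagUnit_mul (j : ImagUnit) (α β : ℝ) :
    ((α : ℍ) + (j : ℍ) * (β : ℍ)).re = α := by
  simp [Quaternion.re_mul, j.re_eq_zero]

theorem norm_sq_add_imagUnit_mul (j : ImagUnit) (α β : ℝ) :
    ‖(α : ℍ) + (j : ℍ) * (β : ℍ)‖ ^ 2 = α ^ 2 + β ^ 2 := by
  obtain ⟨j, hj⟩ := j
  have hr := ImagUnit.re_eq_zero ⟨j, hj⟩
  change j.re = 0 at hr
  have h0 := congrArg QuaternionAlgebra.re hj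
  simp only [Quaternion.re_mul, Quaternion.re_neg, Quaternion.re_one, hr] at h0
  rw [sq, ← Quaternion.normSq_eq_norm_mul_self, Quaternion.normSq_def']
  simp [Quaternion.re_mul, Quaternion.imI_mul, Quaternion.imJ_mul, Quaternion.imK_mul, hr]
  linear_combination (-β ^ 2) * h0

/-- Every quaternion lies in the slice of some imaginary unit. -/
theorem exists_eq_add_imagUnit_mul (ι : ImagUnit) (q : ℍ) :
    ∃ (α β : ℝ) (j : ImagUnit), q = (α : ℍ) + (j : ℍ) * (β : ℍ) := by
  by_cases h : q.im = 0
  -- A real `q` lies in every slice, so the given `ι` serves as a default.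
  · refine ⟨q.re, 0, ι, ?_⟩
    conv_lhs => rw [← Quaternion.re_add_im q, h]
    simp
  · have hn : (‖q.im‖ : ℍ) ≠ 0 := by
      rw [← Quaternion.coe_zero]
      exact fun e => h (norm_eq_zero.1 (Quaternion.coe_injective e))
    have hsq : q.im * q.im = -((‖q.im‖ : ℍ) * (‖q.im‖ : ℍ)) := by
      have h1 := Quaternion.self_mul_star q.im
      rw [Quaternion.star_eq_neg.2 (Quaternion.re_im q),
        Quaternion.normSq_eq_norm_mul_self, Quaternion.coe_mul, mul_neg] at h1
      rw [← h1, neg_neg]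
    -- The unit is the normalized imaginary part; it squares to `-1` by `hsq`.
    refine ⟨q.re, ‖q.im‖, ⟨q.im * (‖q.im‖ : ℍ)⁻¹, ?_⟩, ?_⟩
    · have hc : (‖q.im‖ : ℍ)⁻¹ * q.im = q.im * (‖q.im‖ : ℍ)⁻¹ := by
        rw [← Quaternion.coe_inv, Quaternion.coe_commutes]
      rw [mul_assoc, ← mul_assoc _ q.im, hc, mul_assoc q.im, ← mul_assoc q.im q.im, hsq, neg_mul,
        mul_assoc, ← mul_assoc (‖q.im‖ : ℍ) (‖q.im‖ : ℍ)⁻¹, mul_inv_cancel₀ hn, one_mul,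
        mul_inv_cancel₀ hn]
    · rw [mul_assoc, inv_mul_cancel₀ hn, mul_one, Quaternion.re_add_im]

theorem toSlice_ofReal (ι : ImagUnit) (r : ℝ) : toSlice ι (r : ℂ) = (r : ℍ) := by
  simp [toSlice]

end Quaternions

variable {H : Type*} [NormedAddCommGroup H] [Module ℍᵐᵒᵖ H] [QuaternionicInnerProductSpace H]

/-! ### Reduction of the spherical resolvent set to bijectivity -/

section BoundedInverse

/-- The lower bound makes `D` antilipschitz, so by completeness its range is closed as well as
dense. -/
theorem surjective_of_denseRange_of_bound [CompleteSpace H] {D : H →L[ℍᵐᵒᵖ] H}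
    (hd : DenseRange D) {K : ℝ} (hK : ∀ u, ‖u‖ ≤ K * ‖D u‖) : Function.Surjective D := by
  have ha : AntilipschitzWith K.toNNReal D := by
    refine AntilipschitzWith.of_le_mul_dist fun u v => ?_
    rw [dist_eq_norm, dist_eq_norm, ← map_sub]
    exact (hK _).trans (mul_le_mul_of_nonneg_right (Real.le_coe_toNNReal K) (norm_nonneg _))
  have hu : UniformContinuous D := uniformContinuous_addMonoidHom_of_continuous D.continuous
  have hc := ha.isClosed_range hu
  exact Set.range_eq_univ.1 (hc.closure_eq ▸ hd.closure_range)

/-- The bounded inverse theorem for right linear operators. -/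
theorem exists_bound_of_bijective [CompleteSpace H] {D : H →L[ℍᵐᵒᵖ] H}
    (hD : Function.Bijective D) : ∃ K : ℝ, ∀ u, ‖u‖ ≤ K * ‖D u‖ := by
  -- Over the underlying real Hilbert space the open mapping theorem gives preimages of controlled
  -- norm; injectivity identifies the preimage of `D u` with `u`.
  let _ : InnerProductSpace ℝ H := realInnerProductSpace H
  let R : H →L[ℝ] H :=
    { toFun := D
      map_add' := D.map_add
      map_smul' := fun r u => D.map_smul (MulOpposite.op (r : ℍ)) u
      cont := D.continuous }
  obtain ⟨C, -, hC⟩ := ContinuousLinearMap.exists_preimage_norm_le R hD.2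
  refine ⟨C, fun u => ?_⟩
  obtain ⟨x, hx, hx'⟩ := hC (D u)
  rwa [hD.1 hx] at hx'

theorem mem_sphericalResolventSet_iff_bijective [CompleteSpace H] {T : H →L[ℍᵐᵒᵖ] H} {q : ℍ} :
    q ∈ sphericalResolventSet T ↔ Function.Bijective (sphericalDelta q T) := by
  constructor
  · rintro ⟨hi, hd, K, hK⟩
    exact ⟨(injective_iff_map_eq_zero _).2 hi, surjective_of_denseRange_of_bound hd hK⟩
  · intro h
    exact ⟨(injective_iff_map_eq_zero _).1 h.1, h.2.denseRange, exists_bound_of_bijective h⟩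

end BoundedInverse

/-! ### Splitting of the space and restriction to an eigenspace of `J` -/

section Restriction

variable {J : H →L[ℍᵐᵒᵖ] H} {ι : ImagUnit} {ε : ℤˣ}

/-- `H_±^{Jι}` is the eigenspace `{u | J u = u κ}` with `κ = ±ι`. -/
theorem exists_mem_complexSubspace_iff (J : H →L[ℍᵐᵒᵖ] H) (ι : ImagUnit) (ε : ℤˣ) :
    ∃ κ : ImagUnit, ∀ u : H, u ∈ complexSubspace J ι ε ↔ J u = MulOpposite.op (κ : ℍ) • u := by
  rcases Int.units_eq_one_or ε with rfl | rfl
  · exact ⟨ι, fun u => by rw [mem_complexSubspace, one_smul]⟩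
  · refine ⟨⟨-(ι : ℍ), by rw [neg_mul_neg, ι.2]⟩, fun u => ?_⟩
    rw [mem_complexSubspace, Units.neg_smul, one_smul, MulOpposite.op_neg, neg_smul]

theorem map_mem_complexSubspace {D : H →L[ℍᵐᵒᵖ] H} (hD : Commute D J) {u : H}
    (hu : u ∈ complexSubspace J ι ε) : D u ∈ complexSubspace J ι ε := by
  obtain ⟨κ, hκ⟩ := exists_mem_complexSubspace_iff J ι ε
  rw [hκ] at hu ⊢
  have h := DFunLike.congr_fun hD.eq u
  change D (J u) = J (D u) at h
  rw [← h, hu, map_smul]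

/-- Here `D (J u) = J (D u) = (D u) κ = D (u κ)`, and injectivity cancels `D`. This makes the
restriction surjective when `D` is bijective. -/
theorem mem_complexSubspace_of_map_mem {D : H →L[ℍᵐᵒᵖ] H} (hD : Commute D J)
    (hi : Function.Injective D) {u : H} (hu : D u ∈ complexSubspace J ι ε) :
    u ∈ complexSubspace J ι ε := by
  obtain ⟨κ, hκ⟩ := exists_mem_complexSubspace_iff J ι ε
  rw [hκ] at hu ⊢
  have h := DFunLike.congr_fun hD.eq u
  change D (J u) = J (D u) at h
  apply hi
  rw [h, hu, map_smul]

/-- When `J² = -1`, the space is the sum of `H_±^{Jι}` and its right multiple by some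
quaternion that anticommutes with `ι`. -/
theorem exists_eq_add_smul (hJ : J * J = -1) (ι : ImagUnit) (ε : ℤˣ) :
    ∃ p : ℍ,
      (∀ u : H, ∃ a ∈ complexSubspace J ι ε, ∃ b ∈ complexSubspace J ι ε,
        u = a + MulOpposite.op p • b) ∧
      ∀ a ∈ complexSubspace J ι ε, ∀ b ∈ complexSubspace J ι ε,
        a + MulOpposite.op p • b = 0 → a = 0 ∧ b = 0 := by
  obtain ⟨κ, hκ⟩ := exists_mem_complexSubspace_iff J ι ε
  obtain ⟨p, hp, hpκ⟩ := κ.exists_anticommute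
  have hJJ : ∀ u, J (J u) = -u := fun u => DFunLike.congr_fun hJ u
  have hκκ : ∀ u : H, MulOpposite.op (κ : ℍ) • MulOpposite.op (κ : ℍ) • u = -u := by
    intro u
    rw [smul_smul, ← MulOpposite.op_mul, κ.2, MulOpposite.op_neg, MulOpposite.op_one, neg_smul,
      one_smul]
  have hanti : ∀ u : H, MulOpposite.op (κ : ℍ) • MulOpposite.op p • u
      = -(MulOpposite.op p • MulOpposite.op (κ : ℍ) • u) := by
    intro u
    rw [smul_smul, smul_smul, ← MulOpposite.op_mul, ← MulOpposite.op_mul, hpκ, MulOpposite.op_neg,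
      neg_smul]
  have hpp : ∀ u : H, MulOpposite.op p • MulOpposite.op p⁻¹ • u = u := by
    intro u
    rw [smul_smul, ← MulOpposite.op_mul, inv_mul_cancel₀ hp, MulOpposite.op_one, one_smul]
  have hpp' : ∀ u : H, MulOpposite.op p⁻¹ • MulOpposite.op p • u = u := by
    intro u
    rw [smul_smul, ← MulOpposite.op_mul, mul_inv_cancel₀ hp, MulOpposite.op_one, one_smul]
  have hanti' : ∀ u : H, MulOpposite.op (κ : ℍ) • MulOpposite.op p⁻¹ • u
      = -(MulOpposite.op p⁻¹ • MulOpposite.op (κ : ℍ) • u) := by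
    intro u
    have h := hanti (MulOpposite.op p⁻¹ • u)
    rw [hpp] at h
    rw [h, smul_neg, neg_neg, hpp']
  have hhalf : ∀ u : H, MulOpposite.op (((1 / 2 : ℝ)) : ℍ) • (u + u) = u := by
    intro u
    rw [smul_add, ← add_smul, ← MulOpposite.op_add, ← Quaternion.coe_add, add_halves,
      Quaternion.coe_one, MulOpposite.op_one, one_smul]
  refine ⟨p, fun u => ?_, fun a ha b hb hab => ?_⟩
  -- With `w = u/2`, `u` is the sum of `w - (J w) κ` and `w + (J w) κ`, its components for the
  -- eigenvalues `κ` and `-κ`. Right multiplication by `p⁻¹` moves the second into the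
  -- `κ`-eigenspace.
  · obtain ⟨w, rfl⟩ : ∃ w, w + w = u := ⟨_, (smul_add _ u u).symm.trans (hhalf u)⟩
    refine ⟨w - MulOpposite.op (κ : ℍ) • J w, ?_,
      MulOpposite.op p⁻¹ • (w + MulOpposite.op (κ : ℍ) • J w), ?_, ?_⟩
    · rw [hκ, map_sub, map_smul, hJJ, smul_sub, hκκ, smul_neg]
      abel
    · rw [hκ, map_smul, map_add, map_smul, hJJ, hanti', smul_add (MulOpposite.op (κ : ℍ)), hκκ,
        ← smul_neg]
      congr 1
      rw [smul_neg]
      abel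
    · rw [hpp]
      abel
  · rw [hκ] at ha hb
    -- Applying `J` to `a + b p = 0` gives `a κ + b κ p = 0`, while right multiplication by `κ`
    -- gives `a κ - b κ p = 0`. Adding them leaves `2 a κ = 0`.
    have h := congrArg J hab
    rw [map_add, map_smul, map_zero, ha, hb] at h
    have h' := congrArg (fun x => MulOpposite.op (κ : ℍ) • x) hab
    simp only [smul_add, smul_zero, hanti] at h'
    have h3 : MulOpposite.op (κ : ℍ) • a = 0 := by
      rw [← hhalf (MulOpposite.op (κ : ℍ) • a)]
      refine (congrArg _ ?_).trans (smul_zero _)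
      calc _ = _ := by abel
        _ = (0 : H) + 0 := congrArg₂ (· + ·) h h'
        _ = 0 := add_zero 0
    have ha0 : a = 0 := by
      rw [← neg_eq_zero, ← hκκ, h3, smul_zero]
    refine ⟨ha0, ?_⟩
    rw [ha0, zero_add] at hab
    rw [← hpp' b, hab, smul_zero]

/-- An operator commuting with `J` is bijective iff its restriction to `H_±^{Jι}` is. -/
theorem bijective_restrict_iff (hJ : J * J = -1) {D : H →L[ℍᵐᵒᵖ] H} (hD : Commute D J)
    (h : ∀ u ∈ complexSubspace J ι ε, D u ∈ complexSubspace J ι ε) :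
    Function.Bijective (restrict J ι ε D h) ↔ Function.Bijective D := by
  obtain ⟨p, hex, huniq⟩ := exists_eq_add_smul hJ ι ε
  constructor
  · rintro ⟨hi, hs⟩
    have hi0 : ∀ a ∈ complexSubspace J ι ε, D a = 0 → a = 0 := fun a ha h0 =>
      congrArg Subtype.val ((injective_iff_map_eq_zero _).1 hi ⟨a, ha⟩ (Subtype.ext h0))
    constructor
    · refine (injective_iff_map_eq_zero _).2 fun u hu => ?_
      obtain ⟨a, ha, b, hb, rfl⟩ := hex u
      rw [map_add, map_smul] at hu
      obtain ⟨h1, h2⟩ := huniq _ (h a ha) _ (h b hb) hu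
      rw [hi0 a ha h1, hi0 b hb h2, smul_zero, add_zero]
    · intro v
      obtain ⟨a, ha, b, hb, rfl⟩ := hex v
      obtain ⟨x, hx⟩ := hs ⟨a, ha⟩
      obtain ⟨y, hy⟩ := hs ⟨b, hb⟩
      have hx' : D x = a := congrArg Subtype.val hx
      have hy' : D y = b := congrArg Subtype.val hy
      exact ⟨x + MulOpposite.op p • y, by rw [map_add, map_smul, hx', hy']⟩
  · rintro ⟨hi, hs⟩
    constructor
    · intro a b hab
      exact Subtype.ext (hi (congrArg Subtype.val hab))
    · rintro ⟨v, hv⟩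
      obtain ⟨u, rfl⟩ := hs v
      exact ⟨⟨u, mem_complexSubspace_of_map_mem hD hi hv⟩, rfl⟩

/-- The complex scalar product is the image of the quaternionic one under `ofSlice`, so the defining
identity of the adjoint passes to the subspace. -/
theorem adjoint_restrict [CompleteSpace H] {T : H →L[ℍᵐᵒᵖ] H}
    (h : ∀ u ∈ complexSubspace J ι ε, T u ∈ complexSubspace J ι ε)
    (h' : ∀ u ∈ complexSubspace J ι ε, adjoint T u ∈ complexSubspace J ι ε) :
    ContinuousLinearMap.adjoint (restrict J ι ε T h) = restrict J ι ε (adjoint T) h' := by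
  symm
  rw [ContinuousLinearMap.eq_adjoint_iff]
  intro u v
  exact congrArg (ofSlice ι) (adjoint_inner_left T (u : H) (v : H))

end Restriction

/-! ### Comparison of the spherical and complex spectra -/

section Spectrum

variable {J T : H →L[ℍᵐᵒᵖ] H} {ι : ImagUnit} {ε : ℤˣ}

theorem commute_realScalar (T : H →L[ℍᵐᵒᵖ] H) (r : ℝ) : Commute (realScalar H r) T :=
  ContinuousLinearMap.ext fun u => (T.map_smul (MulOpposite.op (r : ℍ)) u).symm

theorem commute_sphericalDelta (hTJ : Commute T J) (q : ℍ) : Commute (sphericalDelta q T) J :=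
  ((hTJ.mul_left hTJ).sub_left (hTJ.mul_left (commute_realScalar J _))).add_left
    (commute_realScalar J _)

/-- On `H_±^{Jι}` the operator `Δ_q(T)` factors as `(z - T)(z̄ - T)`. -/
theorem restrict_sphericalDelta (h : ∀ u ∈ complexSubspace J ι ε, T u ∈ complexSubspace J ι ε)
    {q : ℍ} {z : ℂ} (hre : q.re = z.re) (hnorm : ‖q‖ ^ 2 = ‖z‖ ^ 2)
    (hD : ∀ u ∈ complexSubspace J ι ε, sphericalDelta q T u ∈ complexSubspace J ι ε) :
    restrict J ι ε (sphericalDelta q T) hD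
      = (algebraMap ℂ _ z - restrict J ι ε T h)
        * (algebraMap ℂ _ (starRingEnd ℂ z) - restrict J ι ε T h) := by
  ext u
  set A := restrict J ι ε T h with hA
  have e : ((algebraMap ℂ _ z - A) * (algebraMap ℂ _ (starRingEnd ℂ z) - A)) u
      = A (A u) - A (((2 * z.re : ℝ) : ℂ) • u) + ((‖z‖ ^ 2 : ℝ) : ℂ) • u := by
    have e1 : (((2 * z.re : ℝ)) : ℂ) = z + starRingEnd ℂ z := (Complex.add_conj z).symm
    have e2 : (((‖z‖ ^ 2 : ℝ)) : ℂ) = z * starRingEnd ℂ z := by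
      rw [Complex.mul_conj, Complex.normSq_eq_norm_sq]
    rw [e1, e2]
    simp only [mul_apply_eq_comp, sub_apply,
      Algebra.algebraMap_eq_smul_one, smul_apply, one_apply_eq_self, map_sub, map_add, map_smul, smul_sub, add_smul, mul_smul]
    rw [smul_comm z]
    abel
  rw [e]
  have hq : (q + star q).re = 2 * z.re := by
    rw [Quaternion.re_add, Quaternion.re_star, hre]
    ring
  -- Both coefficients, `z + z̄` and `z z̄`, are real, and a real number acts identically as a
  -- complex and as a quaternionic scalar.
  change T (T u) - T (MulOpposite.op (((q + star q).re : ℝ) : ℍ) • (u : H))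
      + MulOpposite.op ((‖q‖ ^ 2 : ℝ) : ℍ) • (u : H)
    = T (T u) - T (MulOpposite.op (toSlice ι ((2 * z.re : ℝ) : ℂ)) • (u : H))
      + MulOpposite.op (toSlice ι ((‖z‖ ^ 2 : ℝ) : ℂ)) • (u : H)
  rw [toSlice_ofReal, toSlice_ofReal, hq, hnorm]

theorem mem_sphericalSpectrum_iff [CompleteSpace H] (hJ : J * J = -1) (hTJ : Commute T J)
    (h : ∀ u ∈ complexSubspace J ι ε, T u ∈ complexSubspace J ι ε)
    {q : ℍ} {z : ℂ} (hre : q.re = z.re) (hnorm : ‖q‖ ^ 2 = ‖z‖ ^ 2) :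
    q ∈ sphericalSpectrum T ↔ z ∈ spectrum ℂ (restrict J ι ε T h) ∨
      starRingEnd ℂ z ∈ spectrum ℂ (restrict J ι ε T h) := by
  have hc := commute_sphericalDelta hTJ q
  have hD : ∀ u ∈ complexSubspace J ι ε, sphericalDelta q T u ∈ complexSubspace J ι ε :=
    fun u hu => map_mem_complexSubspace hc hu
  have hcomm : Commute (algebraMap ℂ _ z - restrict J ι ε T h)
      (algebraMap ℂ _ (starRingEnd ℂ z) - restrict J ι ε T h) :=
    ((Algebra.commute_algebraMap_left z _).sub_left
      ((Algebra.commute_algebraMap_right _ _).sub_right (Commute.refl _)))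
  rw [sphericalSpectrum, Set.mem_compl_iff, mem_sphericalResolventSet_iff_bijective,
    ← bijective_restrict_iff hJ hc hD, ← ContinuousLinearMap.isUnit_iff_bijective,
    restrict_sphericalDelta h hre hnorm hD, hcomm.isUnit_mul_iff, not_and_or, spectrum.mem_iff,
    spectrum.mem_iff]

/-- The real part `α` and squared norm `α² + β²` do not depend on `j`: this is the axial symmetry
behind the circularization. -/
theorem mem_sphericalSpectrum_add_imagUnit_mul_iff [CompleteSpace H] (hJ : J * J = -1)
    (hTJ : Commute T J) (h : ∀ u ∈ complexSubspace J ι ε, T u ∈ complexSubspace J ι ε)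
    (j : ImagUnit) (α β : ℝ) :
    (α : ℍ) + (j : ℍ) * (β : ℍ) ∈ sphericalSpectrum T ↔
      (⟨α, β⟩ : ℂ) ∈ spectrum ℂ (restrict J ι ε T h) ∨
      (⟨α, -β⟩ : ℂ) ∈ spectrum ℂ (restrict J ι ε T h) := by
  refine mem_sphericalSpectrum_iff (z := ⟨α, β⟩) hJ hTJ h (re_add_imagUnit_mul j α β) ?_
  rw [norm_sq_add_imagUnit_mul, ← Complex.normSq_eq_norm_sq, Complex.normSq_mk]
  ring

theorem toSlice_image_spectrum [CompleteSpace H] (hJ : J * J = -1)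
    (hTJ : Commute T J) (h : ∀ u ∈ complexSubspace J ι ε, T u ∈ complexSubspace J ι ε) :
    toSlice ι '' (spectrum ℂ (restrict J ι ε T h) ∪
        (starRingEnd ℂ) '' spectrum ℂ (restrict J ι ε T h))
      = sphericalSpectrum T ∩ slice ι := by
  ext q
  constructor
  · rintro ⟨z, hz, rfl⟩
    refine ⟨(mem_sphericalSpectrum_add_imagUnit_mul_iff hJ hTJ h ι z.re z.im).2 ?_,
      z.re, z.im, rfl⟩
    rcases hz with hz | ⟨w, hw, rfl⟩
    · exact Or.inl hz
    · right
      simpa using hw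
  · rintro ⟨hq, α, β, rfl⟩
    refine ⟨⟨α, β⟩, ?_, rfl⟩
    refine ((mem_sphericalSpectrum_add_imagUnit_mul_iff hJ hTJ h ι α β).1 hq).imp id fun hw => ?_
    exact ⟨_, hw, Complex.ext rfl (neg_neg β)⟩

theorem sphericalSpectrum_eq_circularization [CompleteSpace H] (hJ : J * J = -1)
    (hTJ : Commute T J) (h : ∀ u ∈ complexSubspace J ι ε, T u ∈ complexSubspace J ι ε) :
    sphericalSpectrum T = circularization (spectrum ℂ (restrict J ι ε T h)) := by
  ext q
  constructor
  · intro hq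
    obtain ⟨α, β, j, rfl⟩ := exists_eq_add_imagUnit_mul ι q
    rcases (mem_sphericalSpectrum_add_imagUnit_mul_iff hJ hTJ h j α β).1 hq with hz | hz
    · exact ⟨α, β, j, hz, rfl⟩
    -- The conjugate point is absorbed by `α + jβ = α + (-j)(-β)`, so no union with the conjugate
    -- spectrum is needed.
    · refine ⟨α, -β, ⟨-(j : ℍ), by rw [neg_mul_neg, j.2]⟩, hz, ?_⟩
      simp
  · rintro ⟨α, β, j, hz, rfl⟩
    exact (mem_sphericalSpectrum_add_imagUnit_mul_iff hJ hTJ h j α β).2 (Or.inl hz)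

end Spectrum

end QuaternionicHilbert

theorem mainTheorem6 {H : Type*} [NormedAddCommGroup H] [Module ℍᵐᵒᵖ H]
    [QuaternionicInnerProductSpace H] [CompleteSpace H]
    (T J : H →L[ℍᵐᵒᵖ] H)
    (hT : T * QuaternionicHilbert.adjoint T = QuaternionicHilbert.adjoint T * T)
    (hJ : QuaternionicHilbert.adjoint J = -J)
    (hJu : J * QuaternionicHilbert.adjoint J = 1 ∧ QuaternionicHilbert.adjoint J * J = 1)
    (hTJ : T * J = J * T)
    (hTJ' : QuaternionicHilbert.adjoint T * J = J * QuaternionicHilbert.adjoint T)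
    (ι : QuaternionicHilbert.ImagUnit) (ε : ℤˣ) :
    ∃ (h : ∀ u ∈ QuaternionicHilbert.complexSubspace J ι ε,
          T u ∈ QuaternionicHilbert.complexSubspace J ι ε)
      (h' : ∀ u ∈ QuaternionicHilbert.complexSubspace J ι ε,
          QuaternionicHilbert.adjoint T u ∈ QuaternionicHilbert.complexSubspace J ι ε),
      ContinuousLinearMap.adjoint (QuaternionicHilbert.restrict J ι ε T h)
          = QuaternionicHilbert.restrict J ι ε (QuaternionicHilbert.adjoint T) h' ∧
      QuaternionicHilbert.toSlice ι ''
          (spectrum ℂ (QuaternionicHilbert.restrict J ι ε T h) ∪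
            (starRingEnd ℂ) '' spectrum ℂ (QuaternionicHilbert.restrict J ι ε T h))
        = QuaternionicHilbert.sphericalSpectrum T ∩ QuaternionicHilbert.slice ι ∧
      QuaternionicHilbert.sphericalSpectrum T
        = QuaternionicHilbert.circularization
            (spectrum ℂ (QuaternionicHilbert.restrict J ι ε T h)) := by
  -- Substituting `J* = -J` into `J* J = 1` gives the form in which the splitting needs `J`.
  have hJJ : J * J = -1 := by
    ext u
    have h1 : QuaternionicHilbert.adjoint J (J u) = u := DFunLike.congr_fun hJu.2 u
    rw [hJ] at h1
    exact neg_eq_iff_eq_neg.1 h1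
  refine ⟨fun u hu => QuaternionicHilbert.map_mem_complexSubspace hTJ hu,
    fun u hu => QuaternionicHilbert.map_mem_complexSubspace hTJ' hu,
    QuaternionicHilbert.adjoint_restrict _ _,
    QuaternionicHilbert.toSlice_image_spectrum hJJ hTJ _,
    QuaternionicHilbert.sphericalSpectrum_eq_circularization hJJ hTJ _⟩
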